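/- **Setting.** Let $F_X, F_\varepsilon, F_\eta$ be distribution functions of probability laws on $\mathbb R$, with characteristic functions $\Phi_X,\Phi_\varepsilon,\Phi_\eta$, where $\Phi_B(t)=\int e^{itx}F_B(dx)$. For a characteristic function $\Phi_B$ write $\mathcal N_B=\{t\in[-\infty,\infty]:\Phi_B(t)=0\}$, where $\pm\infty\in\mathcal N_B$ means that $\lim_{t\to\pm\infty}\Phi_B(t)$ exists and is $0$. Assume that $\eta$ symmetrizes $\varepsilon$: the characteristic function $\Phi_{\bar\varepsilon}:=\Phi_\varepsilon\overline{\Phi_\eta}$, with distribution function $F_{\bar\varepsilon}$, satisfies $0\le\Phi_{\bar\varepsilon}\le1$ and $\mathcal N_{\bar\varepsilon}=\mathcal N_\varepsilon$. Let $F_{\ddot Y}$ be the distribution function with characteristic function $\Phi_X\Phi_\varepsilon\overline{\Phi_\eta}$ (so $F_{\ddot Y}=F_X*F_{\bar\varepsilon}$), and for $\xi\in\mathbb R$, $m\in\mathbb N_0$ let $$\mathfrak D(\xi,m)=\sum_{\ell=0}^m\sum_{k=0}^\ell\binom{\ell}{k}(-1)^k\,(F_{\ddot Y}*F_{\bar\varepsilon}^{*k})(\xi),$$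 where $F_{\bar\varepsilon}^{*0}$ is the distribution function of the unit mass at $0$. Let $C_{\mathfrak D}$ be the set of all $\xi\in\mathbb R$ that are not an atom of $F_X*F_{\bar\varepsilon}^{*j}$ for any $j\ge1$. Put $\mathcal P_{\bar\varepsilon}(t,m)=(1-\Phi_{\bar\varepsilon}(t))^{m+1}$. For $0<S\le T<\infty$ let $\Psi_{S,T}(t)=\frac{\Phi_X(t)}{2\pi i t}\mathbf 1\{S\le|t|\le T\}$ and $\mathcal F\{\Psi_{S,T}\}(-\xi)=\int_{-\infty}^\infty e^{-i\xi t}\Psi_{S,T}(t)\,dt$; for $0<S<\infty$ let $\mathcal F\{\Psi_{S,\infty}\}(-\xi)=\lim_{T\to\infty}\mathcal F\{\Psi_{S,T}\}(-\xi)$, and let $\mathcal F\{\Psi_{\infty,\infty}\}(-\xi)=0$. **Assumption.** The limit $\Phi_{\bar\varepsilon}(\infty)=\lim_{t\to\infty}\Phi_{\bar\varepsilon}(t)$ exists, and, with $\mathcal P_{\bar\varepsilon}(\infty,m)=(1-\Phi_{\bar\varepsilon}(\infty))^{m+1}$, the total variation of $\mathcal P_{\bar\varepsilon}(\cdot,m)$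 over $[0,\infty]$ is bounded uniformly in $m\in\mathbb N_0$. Moreover there are $K\in\mathbb N_0$ and $\tau_1,\dots,\tau_{2K}\in\mathcal N_\varepsilon\cap[0,\infty]$ such that $\tau_k\le\tau_{k+1}$ and $[\tau_k,\tau_{k+1}]\subseteq\mathcal N_\varepsilon$ for odd $k$, $\tau_k<\tau_{k+1}$ for even $k<2K$, and $$\mathcal N_\varepsilon\cap[0,\infty]=\bigcup_{k=1}^K[\tau_{2k-1},\tau_{2k}].$$ **Theorem.** Under this assumption, for every $\xi\in C_{\mathfrak D}$, the Fourier transforms $\mathcal F\{\Psi_{\tau_{2k-1},\tau_{2k}}\}(-\xi)$ are well defined (all the functions $\Psi_{\tau_{2k-1},T}$ with $T<\infty$ are integrable, and their Fourier transforms at $-\xi$ converge as $T\to\infty$), and $$\lim_{m\to\infty}\mathfrak D(\xi,m)=\frac{F_X(\xi)+F_X(\xi-)}{2}+\sum_{k=1}^K\mathcal F\{\Psi_{\tau_{2k-1},\tau_{2k}}\}(-\xi).$$ The sum over $k$ equals zero if $\mathcal N_\varepsilon$ has Lebesgue measure zero. -/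

import Mathlib

open MeasureTheory ProbabilityTheory Filter Topology Set

noncomputable section

namespace Deconv

/-- The zero set `{t ∈ [-∞, ∞] : Φ(t) = 0}` of the characteristic function `Φ` of `μ`, where
`Φ(±∞) = 0` means that the limit of `Φ` at `±∞` exists and vanishes. -/
def zeroSet (μ : Measure ℝ) : Set EReal :=
  {t | match t with
    | ⊥ => Tendsto (charFun μ) atBot (𝓝 0)
    | ⊤ => Tendsto (charFun μ) atTop (𝓝 0)
    | (s : ℝ) => charFun μ s = 0}

/-- The law of `ε - η₂` for independent `ε ∼ με` and `η₂ ∼ μη`, with characteristic function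
`t ↦ Φ_ε(t) * conj (Φ_η(t))`. -/
def symmError (με μη : Measure ℝ) : Measure ℝ :=
  με.conv (μη.map (fun x => -x))

/-- `η ∼ μη` symmetrizes the error `ε ∼ με`: the characteristic function of
`symmError με μη` takes its values in `[0, 1]` (the upper bound being automatic), and it has the
same zeros in `[-∞, ∞]` as the characteristic function of `ε`. -/
structure IsSymmetrizer (με μη : Measure ℝ) : Prop where
  im_eq_zero : ∀ t : ℝ, (charFun (symmError με μη) t).im = 0
  re_nonneg : ∀ t : ℝ, 0 ≤ (charFun (symmError με μη) t).re
  zeroSet_eq : zeroSet (symmError με μη) = zeroSet με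

/-- The law of `Y - η₂`, where `Y = X + ε` and `X`, `ε`, `η₂` are independent. -/
def symmObs (μX με μη : Measure ℝ) : Measure ℝ :=
  (μX.conv με).conv (μη.map (fun x => -x))

/-- Convolution powers of a measure on the line. -/
def convPow (μ : Measure ℝ) : ℕ → Measure ℝ
  | 0 => Measure.dirac 0
  | k + 1 => μ.conv (convPow μ k)

/-- The deconvolution function `𝔇(ξ, m)`. -/
def deconvFun (μX με μη : Measure ℝ) (ξ : ℝ) (m : ℕ) : ℝ :=
  ∑ l ∈ Finset.range (m + 1), ∑ k ∈ Finset.range (l + 1),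
    (l.choose k : ℝ) * (-1) ^ k *
      cdf ((symmObs μX με μη).conv (convPow (symmError με μη) k)) ξ

/-- The set `D_𝔇` of all atoms of the laws with distribution functions `F_X * ν^{*j}`, `j ≥ 1`,
where `ν = symmError με μη`. -/
def atomSet (μX με μη : Measure ℝ) : Set ℝ :=
  {ξ | ∃ j : ℕ, 1 ≤ j ∧ 0 < (μX.conv (convPow (symmError με μη) j)) {ξ}}

/-- The `m`-power `(1 - Φ)^(m+1)` of a measure `ν` whose characteristic function `Φ` is real. -/
def mPower (ν : Measure ℝ) (m : ℕ) (t : ℝ) : ℝ :=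
  (1 - (charFun ν t).re) ^ (m + 1)

/-- The `m`-power on `[-∞, ∞]`, with its limits as values at `±∞` (provided that they exist). -/
def mPowerExt (ν : Measure ℝ) (m : ℕ) (t : EReal) : ℝ :=
  match t with
  | ⊥ => limUnder atBot (mPower ν m)
  | ⊤ => limUnder atTop (mPower ν m)
  | (s : ℝ) => mPower ν m s

/-- `τ 1, …, τ (2 * K)` are the endpoints of finitely many ordered, pairwise disjoint closed
intervals, possibly reduced to a point, whose union is `N ∩ [0, ∞]`. -/
structure IsIntervalDecomp (N : Set EReal) (K : ℕ) (τ : ℕ → EReal) : Prop where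
  mem : ∀ k, 1 ≤ k → k ≤ 2 * K → τ k ∈ N ∩ Icc 0 ⊤
  odd : ∀ k, 1 ≤ k → k ≤ 2 * K → Odd k → τ k ≤ τ (k + 1) ∧ Icc (τ k) (τ (k + 1)) ⊆ N
  even : ∀ k, 1 ≤ k → k + 1 ≤ 2 * K → Even k → τ k < τ (k + 1)
  eq_iUnion : N ∩ Icc 0 ⊤ = ⋃ k ∈ Finset.Icc 1 K, Icc (τ (2 * k - 1)) (τ (2 * k))

/-- The Fourier transform `∫ e^{itx} q(x) dx`. -/
def fourierTransform (q : ℝ → ℂ) (t : ℝ) : ℂ :=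
  ∫ x : ℝ, Complex.exp (Complex.I * t * x) * q x

open Classical in
/-- `Ψ_{S,T}(t) = Φ_X(t) / (2πit)` for `S ≤ |t| ≤ T`, and zero otherwise. -/
def Psi (μX : Measure ℝ) (S T : EReal) (t : ℝ) : ℂ :=
  if S ≤ ((|t| : ℝ) : EReal) ∧ ((|t| : ℝ) : EReal) ≤ T then
    charFun μX t / (Complex.I * 2 * Real.pi * t) else 0

/-- The Fourier transform of `Ψ_{S,T}`, for `0 < S`, at the point `t`. For `T = ∞` it is
the limit of the Fourier transforms of `Ψ_{S,R}` as `R → ∞`. -/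
def fourierPsi (μX : Measure ℝ) (S T : EReal) (t : ℝ) : ℂ :=
  match T with
  | ⊥ => 0
  | ⊤ => limUnder atTop (fun R : ℝ => fourierTransform (Psi μX S R) t)
  | (R : ℝ) => fourierTransform (Psi μX S R) t

end Deconv

end

/-!
Write `φ` for the characteristic function of `symmError με μη`, which takes values in `[0, 1]`,
`P m = (1 - φ) ^ (m + 1)`, and `h t = Im (e^{-iξt} Φ_X(t)) / (πt)` for `t > 0`
(`inversionKernel`).

The inversion formula of Gil-Pelaez (`tendsto_integral_inversionKernel`) says that the mean of the
one-sided limits of a distribution function at `ξ` is `1 / 2 - ∫ h`, the integral over `(0, ∞)`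
being improper at both ends. It follows from Fubini's theorem and the Dirichlet integral. The laws
entering `𝔇(ξ, m)` have the kernels `φ ^ (k + 1) * h` and no atom at `ξ`, and the binomial sum of
the powers is `1 - P m`. Hence `𝔇(ξ, m)` differs from `(F_X(ξ) + F_X(ξ-)) / 2` by the improper
integral `∫ P m * h` (`tendsto_integral_mPower_mul`).

As `m → ∞`, `P m` tends pointwise to the indicator of the zero set of `φ`. Since `h` need not be
absolutely integrable near `0` or `∞`, dominated convergence applies on compact subintervals of
`(0, ∞)` only. Near the ends, summation by parts bounds the integral of `P m * h` by
`1 +` the variation of `P m`, times the largest integral of `h` over a subinterval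
(`abs_integral_mul_le_of_eVariationOn_le`). The variation is bounded uniformly in `m` and the
integrals of `h` satisfy the Cauchy criterion, so limit and improper integral may be exchanged
(`tendsto_of_tendsto_integral_mul`).

The resulting integral of `h` over the zero set splits into the integrals over the intervals
`[τ (2k-1), τ (2k)]`, and each is the Fourier transform at `-ξ` of the corresponding `Psi`, the
contributions of `t` and `-t` being complex conjugates (`fourierTransform_Psi_coe`). All these
intervals stay away from `0` because `φ 0 = 1`.
-/

noncomputable section

namespace Deconv

/-! ### The sine integral -/

/-- The sine integral `∫₀ᵀ sin t / t dt`. -/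
def sineIntegral (T : ℝ) : ℝ := ∫ t in (0 : ℝ)..T, Real.sinc t

lemma continuous_sineIntegral : Continuous sineIntegral :=
  intervalIntegral.continuous_primitive
    (fun _ _ => Real.continuous_sinc.intervalIntegrable _ _) 0

lemma sineIntegral_zero : sineIntegral 0 = 0 := by simp [sineIntegral]

lemma sineIntegral_neg (T : ℝ) : sineIntegral (-T) = -sineIntegral T := by
  have h := intervalIntegral.integral_comp_neg (a := 0) (b := T) (f := Real.sinc)
  simp only [Real.sinc_neg, neg_zero] at h
  rw [sineIntegral, sineIntegral, h, intervalIntegral.integral_symm]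

lemma integral_sin_mul_exp_neg (y T : ℝ) :
    ∫ t in (0 : ℝ)..T, Real.sin t * Real.exp (-(t * y)) =
      (1 - Real.exp (-(T * y)) * (Real.cos T + y * Real.sin T)) / (1 + y ^ 2) := by
  have hy : (1 + y ^ 2) ≠ 0 := by positivity
  have hd : ∀ t ∈ uIcc 0 T, HasDerivAt
      (fun t => -(Real.exp (-(t * y)) * (Real.cos t + y * Real.sin t)) / (1 + y ^ 2))
      (Real.sin t * Real.exp (-(t * y))) t := by
    intro t _
    have h1 : HasDerivAt (fun t : ℝ => Real.exp (-(t * y))) (Real.exp (-(t * y)) * (-(1 * y))) t :=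
      (((hasDerivAt_id t).mul_const y).neg).exp
    have h2 := (Real.hasDerivAt_cos t).add ((Real.hasDerivAt_sin t).const_mul y)
    refine (((h1.mul h2).neg).div_const (1 + y ^ 2)).congr_deriv ?_
    simp only [Pi.add_apply]
    field_simp
    ring
  rw [intervalIntegral.integral_eq_sub_of_hasDerivAt hd
    (Continuous.intervalIntegrable (by fun_prop) _ _)]
  simp
  field_simp
  ring

/-- Writing `1 / t` as a Laplace integral and exchanging the integrals. -/
lemma sineIntegral_eq_integral {T : ℝ} (hT : 0 < T) :
    sineIntegral T = ∫ y in Ioi (0 : ℝ),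
      (1 - Real.exp (-(T * y)) * (Real.cos T + y * Real.sin T)) / (1 + y ^ 2) := by
  have hexp : ∀ t : ℝ, 0 < t → IntegrableOn (fun y => Real.exp (-(t * y))) (Ioi 0) := by
    intro t ht
    simpa [neg_mul] using integrableOn_exp_mul_Ioi (a := -t) (by linarith) 0
  have hval : ∀ t : ℝ, 0 < t → ∫ y in Ioi (0 : ℝ), Real.exp (-(t * y)) = 1 / t := by
    intro t ht
    have := integral_exp_mul_Ioi (a := -t) (by linarith) 0
    simpa [neg_mul] using this
  have hint : Integrable (Function.uncurry fun t y : ℝ => Real.sin t * Real.exp (-(t * y)))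
      ((volume.restrict (Ioc 0 T)).prod (volume.restrict (Ioi 0))) := by
    rw [integrable_prod_iff (Continuous.aestronglyMeasurable (by fun_prop))]
    constructor
    · filter_upwards [ae_restrict_mem measurableSet_Ioc] with t ht
      exact (hexp t ht.1).const_mul (Real.sin t)
    · have h1 : Integrable (fun t => |Real.sinc t|) (volume.restrict (Ioc 0 T)) :=
        (Real.continuous_sinc.abs.integrableOn_Icc (a := 0) (b := T)).mono_set Ioc_subset_Icc_self
      refine h1.congr ?_
      filter_upwards [ae_restrict_mem measurableSet_Ioc] with t ht
      simp only [Function.uncurry, norm_mul, Real.norm_eq_abs, Real.abs_exp]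
      rw [integral_const_mul, hval t ht.1, Real.sinc_of_ne_zero ht.1.ne', abs_div,
        abs_of_pos ht.1]
      ring
  have hswap := integral_integral_swap hint
  rw [sineIntegral, intervalIntegral.integral_of_le hT.le]
  calc ∫ t in Ioc 0 T, Real.sinc t
      = ∫ t in Ioc 0 T, ∫ y in Ioi (0 : ℝ), Real.sin t * Real.exp (-(t * y)) := by
        refine setIntegral_congr_fun measurableSet_Ioc fun t ht => ?_
        rw [integral_const_mul, hval t ht.1, Real.sinc_of_ne_zero ht.1.ne']
        ring
    _ = _ := hswap
    _ = _ := by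
        refine setIntegral_congr_fun measurableSet_Ioi fun y _ => ?_
        rw [← intervalIntegral.integral_of_le hT.le, integral_sin_mul_exp_neg]

/-- The Dirichlet integral with a rate: the Laplace representation differs from
`∫₀^∞ dy / (1 + y²) = π / 2` by at most `∫₀^∞ 2 e^{-Ty} dy`. -/
lemma abs_sineIntegral_sub_le {T : ℝ} (hT : 0 < T) :
    |sineIntegral T - Real.pi / 2| ≤ 2 / T := by
  have hpi : ∫ y in Ioi (0 : ℝ), (1 + y ^ 2)⁻¹ = Real.pi / 2 := by
    rw [integral_Ioi_inv_one_add_sq]; simp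
  have hexp : IntegrableOn (fun y => 2 * Real.exp (-(T * y))) (Ioi 0) := by
    have h : IntegrableOn (fun y => Real.exp (-(T * y))) (Ioi 0) := by
      simpa [neg_mul] using integrableOn_exp_mul_Ioi (a := -T) (by linarith) 0
    exact h.const_mul 2
  have hval : ∫ y in Ioi (0 : ℝ), 2 * Real.exp (-(T * y)) = 2 / T := by
    have := integral_exp_mul_Ioi (a := -T) (by linarith) 0
    rw [integral_const_mul]
    simp only [neg_mul, mul_zero, Real.exp_zero] at this
    rw [this]; field_simp
  have hb : ∀ y ∈ Ioi (0 : ℝ),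
      ‖Real.exp (-(T * y)) * (Real.cos T + y * Real.sin T) / (1 + y ^ 2)‖ ≤
        2 * Real.exp (-(T * y)) := by
    intro y hy
    have hy : 0 < y := hy
    rw [norm_div, norm_mul, Real.norm_eq_abs, Real.norm_eq_abs, Real.norm_eq_abs, Real.abs_exp,
      abs_of_pos (show 0 < 1 + y ^ 2 by positivity), div_le_iff₀ (by positivity)]
    have h1 : |Real.cos T + y * Real.sin T| ≤ 1 + y := by
      refine (abs_add_le _ _).trans ?_
      rw [abs_mul, abs_of_pos hy]
      have := Real.abs_cos_le_one T
      have := mul_le_mul_of_nonneg_left (Real.abs_sin_le_one T) hy.le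
      linarith
    have h2 : 1 + y ≤ 2 * (1 + y ^ 2) := by nlinarith [sq_nonneg (y - 1 / 4)]
    calc _ ≤ Real.exp (-(T * y)) * (2 * (1 + y ^ 2)) := by
            gcongr; exact h1.trans h2
      _ = _ := by ring
  have hi : IntegrableOn
      (fun y => Real.exp (-(T * y)) * (Real.cos T + y * Real.sin T) / (1 + y ^ 2)) (Ioi 0) := by
    refine hexp.mono' ?_ ((ae_restrict_iff' measurableSet_Ioi).2 (ae_of_all _ hb))
    exact Measurable.aestronglyMeasurable (by fun_prop)
  have heq : sineIntegral T - Real.pi / 2 =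
      -∫ y in Ioi (0 : ℝ),
        Real.exp (-(T * y)) * (Real.cos T + y * Real.sin T) / (1 + y ^ 2) := by
    rw [sineIntegral_eq_integral hT, ← hpi, ← integral_neg, ← integral_sub]
    · refine setIntegral_congr_fun measurableSet_Ioi fun y _ => ?_
      ring
    · refine (integrable_inv_one_add_sq.integrableOn.sub hi).congr (ae_of_all _ fun y => ?_)
      simp only [Pi.sub_apply]
      ring
    · exact integrable_inv_one_add_sq.integrableOn
  rw [heq, abs_neg, ← hval, ← Real.norm_eq_abs]
  exact norm_integral_le_of_norm_le hexp ((ae_restrict_iff' measurableSet_Ioi).2 (ae_of_all _ hb))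

lemma abs_sineIntegral_le (T : ℝ) : |sineIntegral T| ≤ 4 := by
  wlog hT : 0 ≤ T generalizing T
  · rw [← abs_neg, ← sineIntegral_neg]
    exact this (-T) (by linarith)
  rcases le_total T 1 with h1 | h1
  · have := intervalIntegral.norm_integral_le_of_norm_le_const (a := 0) (b := T) (C := 1)
      (f := Real.sinc) (fun t _ => Real.abs_sinc_le_one t)
    rw [Real.norm_eq_abs] at this
    refine this.trans ?_
    rw [sub_zero, abs_of_nonneg hT]
    linarith
  · have h2 := abs_sineIntegral_sub_le (by linarith : 0 < T)
    have h3 : 2 / T ≤ 2 := by rw [div_le_iff₀ (by linarith)]; linarith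
    have h4 := Real.pi_le_four
    have h5 := Real.pi_pos
    rw [abs_le] at h2 ⊢
    constructor <;> linarith

lemma tendsto_sineIntegral_atTop : Tendsto sineIntegral atTop (𝓝 (Real.pi / 2)) := by
  rw [tendsto_iff_norm_sub_tendsto_zero]
  refine squeeze_zero' (Eventually.of_forall fun _ => norm_nonneg _) ?_
    (tendsto_const_nhds.div_atTop tendsto_id : Tendsto (fun T : ℝ => 2 / T) atTop (𝓝 0))
  filter_upwards [eventually_gt_atTop 0] with T hT using abs_sineIntegral_sub_le hT

lemma tendsto_sineIntegral_mul (c : ℝ) :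
    Tendsto (fun T => sineIntegral (c * T)) atTop (𝓝 (Real.pi / 2 * Real.sign c)) := by
  rcases lt_trichotomy c 0 with hc | rfl | hc
  · have h := (tendsto_sineIntegral_atTop.comp
      (tendsto_id.const_mul_atTop (neg_pos.2 hc))).neg
    rw [Real.sign_of_neg hc, mul_neg_one]
    refine h.congr fun T => ?_
    simp [sineIntegral_neg]
  · simp [sineIntegral_zero]
  · rw [Real.sign_of_pos hc, mul_one]
    exact tendsto_sineIntegral_atTop.comp (tendsto_id.const_mul_atTop hc)

/-! ### Integrals against functions of bounded variation -/

/-- Along a partition, the summation by parts formula turns `∑ f (t i) ΔH` into a sum of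
`H` against the increments of `f`. -/
lemma abs_sum_mul_sub_le {F H : ℕ → ℝ} {n : ℕ} {V δ : ℝ} (hδ : ∀ i ≤ n, |H i| ≤ δ)
    (hH : H 0 = 0) (hV : ∑ i ∈ Finset.range n, |F (i + 1) - F i| ≤ V) :
    |∑ i ∈ Finset.range n, F (i + 1) * (H (i + 1) - H i)| ≤ (|F n| + V) * δ := by
  have hδ0 : 0 ≤ δ := (abs_nonneg _).trans (hδ 0 (Nat.zero_le _))
  have hsum : ∀ k : ℕ, ∑ i ∈ Finset.range k, F (i + 1) * (H (i + 1) - H i) =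
      F k * H k - ∑ i ∈ Finset.range k, H i * (F (i + 1) - F i) := by
    intro k
    induction k with
    | zero => simp [hH]
    | succ k ih => rw [Finset.sum_range_succ, ih, Finset.sum_range_succ]; ring
  rw [hsum, add_mul]
  refine (abs_sub _ _).trans (add_le_add ?_ ?_)
  · rw [abs_mul]
    exact mul_le_mul_of_nonneg_left (hδ n le_rfl) (abs_nonneg _)
  · calc |∑ i ∈ Finset.range n, H i * (F (i + 1) - F i)|
        ≤ ∑ i ∈ Finset.range n, |H i * (F (i + 1) - F i)| := Finset.abs_sum_le_sum_abs _ _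
      _ ≤ ∑ i ∈ Finset.range n, δ * |F (i + 1) - F i| := by
          refine Finset.sum_le_sum fun i hi => ?_
          rw [abs_mul]
          exact mul_le_mul_of_nonneg_right (hδ i (Finset.mem_range.1 hi).le) (abs_nonneg _)
      _ ≤ V * δ := by
          rw [← Finset.mul_sum, mul_comm]
          exact mul_le_mul_of_nonneg_right hV hδ0

lemma sum_abs_sub_le_of_eVariationOn_le {f : ℝ → ℝ} {s : Set ℝ} {V : ℝ} (hV0 : 0 ≤ V)
    (hV : eVariationOn f s ≤ ENNReal.ofReal V) {n : ℕ} {u : ℕ → ℝ}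
    (hu : MonotoneOn u (Iic n)) (us : ∀ i ≤ n, u i ∈ s) :
    ∑ i ∈ Finset.range n, |f (u (i + 1)) - f (u i)| ≤ V := by
  have h := (eVariationOn.sum_le_of_monotoneOn_Iic (f := f) hu us).trans hV
  simp_rw [edist_dist, Real.dist_eq] at h
  rw [← ENNReal.ofReal_sum_of_nonneg (fun _ _ => abs_nonneg _)] at h
  exact (ENNReal.ofReal_le_ofReal_iff hV0).1 h

/-- A form of the second mean value theorem: the integral of `f * h` is controlled by the
variation of `f` and by the primitive of `h`, with no recourse to `∫ |h|`. -/
lemma abs_integral_mul_le_of_eVariationOn_le {f h : ℝ → ℝ} {a b V δ : ℝ} (hab : a < b)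
    (hf : ContinuousOn f (Icc a b)) (hh : IntervalIntegrable h volume a b) (hV0 : 0 ≤ V)
    (hV : eVariationOn f (Icc a b) ≤ ENNReal.ofReal V)
    (hδ : ∀ s ∈ Icc a b, |∫ t in a..s, h t| ≤ δ) :
    |∫ t in a..b, f t * h t| ≤ (|f b| + V) * δ := by
  set A : ℝ := ∫ t in a..b, |h t| with hA
  have hA0 : 0 ≤ A := intervalIntegral.integral_nonneg hab.le fun _ _ => abs_nonneg _
  -- The Riemann-Stieltjes sums approximate the integral up to `ε * A`.
  suffices key : ∀ ε > 0, |∫ t in a..b, f t * h t| ≤ (|f b| + V) * δ + ε * A by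
    refine le_of_forall_pos_le_add fun ε hε => ?_
    refine (key (ε / (A + 1)) (by positivity)).trans ?_
    gcongr
    rw [div_mul_eq_mul_div, div_le_iff₀ (by positivity)]
    nlinarith
  intro ε hε
  obtain ⟨η, hη, hη'⟩ := Metric.uniformContinuousOn_iff.1
    (isCompact_Icc.uniformContinuousOn_of_continuous hf) ε hε
  obtain ⟨n, hn⟩ := exists_nat_gt ((b - a) / η)
  have hba : 0 < b - a := sub_pos.2 hab
  have hn0 : (0 : ℝ) < n := lt_of_le_of_lt (by positivity) hn
  have hstep : (b - a) / n < η := by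
    rw [div_lt_iff₀ hη] at hn
    rw [div_lt_iff₀ hn0]; linarith
  set d : ℝ := (b - a) / n with hd
  have hd0 : 0 < d := by positivity
  have hdn : n * d = b - a := by rw [hd]; field_simp
  set u : ℕ → ℝ := fun i => a + i * d with hu
  have hu0 : u 0 = a := by simp [hu]
  have hun : u n = b := by simp only [hu, hdn]; ring
  have humono : Monotone u := fun i j hij => by
    simp only [hu]
    have : (i : ℝ) ≤ j := by exact_mod_cast hij
    gcongr
  have hmem : ∀ i ≤ n, u i ∈ Icc a b := fun i hi =>
    ⟨hu0 ▸ humono (Nat.zero_le i), hun ▸ humono hi⟩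
  have husucc : ∀ i, u (i + 1) = u i + d := fun i => by simp only [hu]; push_cast; ring
  have hsub : ∀ s ∈ Icc a b, ∀ t ∈ Icc a b, uIcc s t ⊆ uIcc a b := fun s hs t ht => by
    rw [uIcc_of_le hab.le]; exact (uIcc_subset_Icc hs ht)
  have hhi : ∀ s ∈ Icc a b, ∀ t ∈ Icc a b, IntervalIntegrable h volume s t :=
    fun s hs t ht => hh.mono_set (hsub s hs t ht)
  have hfi : ∀ s ∈ Icc a b, ∀ t ∈ Icc a b, IntervalIntegrable (fun x => f x * h x) volume s t :=
    fun s hs t ht => (hhi s hs t ht).continuousOn_mul (hf.mono (uIcc_subset_Icc hs ht))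
  have hleft : a ∈ Icc a b := left_mem_Icc.2 hab.le
  set H : ℕ → ℝ := fun i => ∫ t in a..u i, h t with hH
  have hHsub : ∀ i < n, H (i + 1) - H i = ∫ t in u i..u (i + 1), h t := fun i hi =>
    intervalIntegral.integral_interval_sub_left (hhi _ hleft _ (hmem _ hi))
      (hhi _ hleft _ (hmem _ hi.le))
  have habel := abs_sum_mul_sub_le (F := fun i => f (u i)) (H := H) (n := n) (V := V) (δ := δ)
    (fun i hi => hδ _ (hmem i hi)) (by simp [hH, hu0])
    (sum_abs_sub_le_of_eVariationOn_le hV0 hV (humono.monotoneOn _) hmem)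
  have hI : ∫ t in a..b, f t * h t = ∑ i ∈ Finset.range n, ∫ t in u i..u (i + 1), f t * h t := by
    rw [intervalIntegral.sum_integral_adjacent_intervals
      (fun i hi => hfi _ (hmem i hi.le) _ (hmem _ hi)), hu0, hun]
  have hA' : A = ∑ i ∈ Finset.range n, ∫ t in u i..u (i + 1), |h t| := by
    rw [intervalIntegral.sum_integral_adjacent_intervals
      (fun i hi => (hhi _ (hmem i hi.le) _ (hmem _ hi)).abs), hu0, hun]
  have hdiff : |(∫ t in a..b, f t * h t) -
      ∑ i ∈ Finset.range n, f (u (i + 1)) * (H (i + 1) - H i)| ≤ ε * A := by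
    rw [hI, ← Finset.sum_sub_distrib, hA', Finset.mul_sum]
    refine (Finset.abs_sum_le_sum_abs _ _).trans (Finset.sum_le_sum fun i hi => ?_)
    have hi := Finset.mem_range.1 hi
    have hle : u i ≤ u (i + 1) := humono (Nat.le_succ i)
    have hint := hhi _ (hmem i hi.le) _ (hmem _ hi)
    rw [hHsub i hi, ← intervalIntegral.integral_const_mul, ← intervalIntegral.integral_sub
      (hfi _ (hmem i hi.le) _ (hmem _ hi)) (hint.const_mul _), ← Real.norm_eq_abs,
      ← intervalIntegral.integral_const_mul]
    refine intervalIntegral.norm_integral_le_of_norm_le hle (ae_of_all _ fun t ht => ?_)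
      (hint.abs.const_mul ε)
    rw [← sub_mul, norm_mul, Real.norm_eq_abs, Real.norm_eq_abs]
    refine mul_le_mul_of_nonneg_right (le_of_lt ?_) (abs_nonneg _)
    have htm : t ∈ Icc a b := ⟨(hmem i hi.le).1.trans ht.1.le, ht.2.trans (hmem _ hi).2⟩
    refine hη' t htm _ (hmem _ hi) ?_
    rw [Real.dist_eq, abs_lt]
    have := husucc i
    constructor <;> linarith [ht.1, ht.2]
  simp only [hun] at habel
  rw [abs_le] at hdiff habel ⊢
  constructor <;> linarith [hdiff.1, hdiff.2, habel.1, habel.2]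

/-- If the integrals `∫ₐᵇ h` have a limit as `a → 0` and `b → ∞`, they are small near both ends,
and so are, uniformly in `n`, the integrals of `f n * h`. Between the ends, dominated convergence
applies. -/
lemma tendsto_of_tendsto_integral_mul {f : ℕ → ℝ → ℝ} {f' h : ℝ → ℝ} {V I J' : ℝ} {J : ℕ → ℝ}
    (hf : ∀ n, ContinuousOn (f n) (Ioi 0)) (hf1 : ∀ n t, 0 < t → |f n t| ≤ 1)
    (hV0 : 0 ≤ V) (hV : ∀ n, eVariationOn (f n) (Ioi 0) ≤ ENNReal.ofReal V)
    (hff' : ∀ t, 0 < t → Tendsto (fun n => f n t) atTop (𝓝 (f' t)))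
    (hh : ∀ a b, 0 < a → 0 < b → IntervalIntegrable h volume a b)
    (hI : Tendsto (fun p : ℝ × ℝ => ∫ t in p.1..p.2, h t) (𝓝[>] 0 ×ˢ atTop) (𝓝 I))
    (hJ : ∀ n, Tendsto (fun p : ℝ × ℝ => ∫ t in p.1..p.2, f n t * h t)
      (𝓝[>] 0 ×ˢ atTop) (𝓝 (J n)))
    (hJ' : Tendsto (fun p : ℝ × ℝ => ∫ t in p.1..p.2, f' t * h t)
      (𝓝[>] 0 ×ˢ atTop) (𝓝 J')) :
    Tendsto J atTop (𝓝 J') := by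
  have hfin : ∀ n a b, 0 < a → 0 < b → IntervalIntegrable (fun t => f n t * h t) volume a b :=
    fun n a b ha hb => (hh a b ha hb).continuousOn_mul
      ((hf n).mono fun t ht => lt_of_lt_of_le (lt_min ha hb) ht.1)
  have hmid : ∀ a b, 0 < a → 0 < b →
      Tendsto (fun n => ∫ t in a..b, f n t * h t) atTop (𝓝 (∫ t in a..b, f' t * h t)) := by
    intro a b ha hb
    have hpos : ∀ t, t ∈ uIoc a b → 0 < t := fun t ht => lt_trans (lt_min ha hb) ht.1
    refine intervalIntegral.tendsto_integral_filter_of_dominated_convergence (fun t => |h t|)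
      (Eventually.of_forall fun n => (hfin n a b ha hb).def'.aestronglyMeasurable)
      (Eventually.of_forall fun n => ae_of_all _ fun t ht => ?_) (hh a b ha hb).abs
      (ae_of_all _ fun t ht => (hff' t (hpos t ht)).mul_const _)
    rw [norm_mul]
    exact mul_le_of_le_one_left (norm_nonneg _) (hf1 n t (hpos t ht))
  rw [Metric.tendsto_atTop]
  intro ε hε
  set δ : ℝ := ε / (16 * (1 + V)) with hδ
  have hδ0 : 0 < δ := by positivity
  have hδV : (1 + V) * (2 * δ) = ε / 8 := by rw [hδ]; field_simp; norm_num
  -- Beyond `a₀` and `b₀`, the improper integral of `h` has converged up to `δ`.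
  obtain ⟨A, hA, hAδ⟩ := (eventually_prod_iff.1 (hI.eventually (Metric.ball_mem_nhds I hδ0)))
  obtain ⟨B, hB, hAB⟩ := hAδ
  obtain ⟨a₀, ha₀, hA'⟩ : ∃ a₀ > 0, ∀ a, 0 < a → a ≤ a₀ → A a := by
    obtain ⟨c, hc, hcA⟩ := mem_nhdsGT_iff_exists_Ioc_subset.1 hA
    exact ⟨c, hc, fun a h1 h2 => hcA ⟨h1, h2⟩⟩
  obtain ⟨b₁, hB'⟩ := eventually_atTop.1 hB
  set b₀ : ℝ := max b₁ (a₀ + 1) with hb₀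
  have hb₀pos : 0 < b₀ := by have := le_max_right b₁ (a₀ + 1); linarith
  have hnear : ∀ a b, 0 < a → a ≤ a₀ → b₀ ≤ b → |(∫ t in a..b, h t) - I| < δ :=
    fun a b h1 h2 h3 => hAB (hA' a h1 h2) (hB' b ((le_max_left _ _).trans h3))
  -- The integral of `f n * h` over an interval that carries only small integrals of `h`.
  have hpiece : ∀ n a b, 0 < a → a < b → (∀ s ∈ Icc a b, |∫ t in a..s, h t| ≤ 2 * δ) →
      |∫ t in a..b, f n t * h t| ≤ ε / 8 := by
    intro n a b ha hab hs
    have hsub : Icc a b ⊆ Ioi 0 := fun t ht => lt_of_lt_of_le ha ht.1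
    refine (abs_integral_mul_le_of_eVariationOn_le hab ((hf n).mono hsub)
      (hh a b ha (ha.trans hab)) hV0 ((eVariationOn.mono _ hsub).trans (hV n)) hs).trans ?_
    rw [← hδV]
    have := hf1 n b (ha.trans hab)
    gcongr
  have htail : ∀ n a b, 0 < a → a < a₀ → b₀ < b →
      |(∫ t in a..b, f n t * h t) - ∫ t in a₀..b₀, f n t * h t| ≤ ε / 4 := by
    intro n a b ha haa hbb
    have hbpos : 0 < b := hb₀pos.trans hbb
    have h1 := hpiece n a a₀ ha haa (fun s hs => by
      have hspos : 0 < s := lt_of_lt_of_le ha hs.1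
      have e := intervalIntegral.integral_add_adjacent_intervals (hh a s ha hspos)
        (hh s b₀ hspos hb₀pos)
      have e1 := abs_lt.1 (hnear a b₀ ha haa.le le_rfl)
      have e2 := abs_lt.1 (hnear s b₀ hspos hs.2 le_rfl)
      rw [abs_le]; constructor <;> linarith [e1.1, e1.2, e2.1, e2.2])
    have h2 := hpiece n b₀ b hb₀pos hbb (fun s hs => by
      have hspos : 0 < s := lt_of_lt_of_le hb₀pos hs.1
      have e := intervalIntegral.integral_add_adjacent_intervals (hh a₀ b₀ ha₀ hb₀pos)
        (hh b₀ s hb₀pos hspos)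
      have e1 := abs_lt.1 (hnear a₀ b₀ ha₀ le_rfl le_rfl)
      have e2 := abs_lt.1 (hnear a₀ s ha₀ le_rfl hs.1)
      rw [abs_le]; constructor <;> linarith [e1.1, e1.2, e2.1, e2.2])
    have e3 := intervalIntegral.integral_add_adjacent_intervals (hfin n a a₀ ha ha₀)
      (hfin n a₀ b₀ ha₀ hb₀pos)
    have e4 := intervalIntegral.integral_add_adjacent_intervals (hfin n a b₀ ha hb₀pos)
      (hfin n b₀ b hb₀pos hbpos)
    rw [abs_le] at h1 h2 ⊢
    constructor <;> linarith [h1.1, h1.2, h2.1, h2.2]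
  have hev : ∀ᶠ p : ℝ × ℝ in 𝓝[>] 0 ×ˢ atTop, (0 < p.1 ∧ p.1 < a₀) ∧ b₀ < p.2 :=
    Filter.Eventually.prod_mk (Ioo_mem_nhdsGT ha₀) (eventually_gt_atTop b₀)
  have hJn : ∀ n, |J n - ∫ t in a₀..b₀, f n t * h t| ≤ ε / 4 := fun n =>
    le_of_tendsto ((hJ n).sub_const _).abs (hev.mono fun p hp => htail n _ _ hp.1.1 hp.1.2 hp.2)
  -- The bound on the tails passes to the limit `n → ∞`, so `f'` itself needs no variation bound.
  have hJlim : |J' - ∫ t in a₀..b₀, f' t * h t| ≤ ε / 4 := by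
    refine le_of_tendsto (hJ'.sub_const _).abs (hev.mono fun p hp => ?_)
    exact le_of_tendsto ((hmid _ _ hp.1.1 (hb₀pos.trans hp.2)).sub (hmid _ _ ha₀ hb₀pos)).abs
      (Eventually.of_forall fun n => htail n _ _ hp.1.1 hp.1.2 hp.2)
  obtain ⟨N, hN⟩ := Metric.tendsto_atTop.1 (hmid a₀ b₀ ha₀ hb₀pos) (ε / 4) (by positivity)
  refine ⟨N, fun n hn => ?_⟩
  have e1 := abs_lt.1 (hN n hn)
  have e2 := abs_le.1 (hJn n)
  have e3 := abs_le.1 hJlim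
  rw [Real.dist_eq, abs_lt]
  constructor <;> linarith [e1.1, e1.2, e2.1, e2.2, e3.1, e3.2]

/-! ### The inversion formula -/

/-- The integrand `Im (e^{-iξt} Φ(t)) / (πt)` of the inversion formula for the distribution
function of `μ` at `ξ`, used for `t > 0` only. -/
def inversionKernel (μ : Measure ℝ) (ξ t : ℝ) : ℝ :=
  (Complex.exp (-(ξ * t) * Complex.I) * charFun μ t).im / (Real.pi * t)

section Inversion

variable {μ : Measure ℝ} [IsProbabilityMeasure μ]

lemma inversionKernel_eq_integral (ξ t : ℝ) :
    inversionKernel μ ξ t = (∫ x, Real.sin ((x - ξ) * t) ∂μ) / (Real.pi * t) := by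
  have hint : Integrable (fun x : ℝ => Complex.exp (((x - ξ) * t : ℝ) * Complex.I)) μ := by
    refine (integrable_const (1 : ℝ)).mono' (Continuous.aestronglyMeasurable (by fun_prop))
      (ae_of_all _ fun x => ?_)
    rw [Complex.norm_exp_ofReal_mul_I]
  rw [inversionKernel, charFun_apply_real, ← integral_const_mul]
  have h1 : (fun x : ℝ => Complex.exp (-(ξ * t) * Complex.I) * Complex.exp (t * x * Complex.I)) =
      fun x : ℝ => Complex.exp (((x - ξ) * t : ℝ) * Complex.I) := by
    funext x
    rw [← Complex.exp_add]
    push_cast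
    ring_nf
  rw [h1, ← Complex.imCLM_apply, ← Complex.imCLM.integral_comp_comm hint]
  simp only [Complex.imCLM_apply, Complex.exp_ofReal_mul_I_im]

lemma continuousOn_inversionKernel (ξ : ℝ) : ContinuousOn (inversionKernel μ ξ) (Ioi 0) := by
  refine ContinuousOn.div (Continuous.continuousOn ?_) (by fun_prop) fun t ht =>
    mul_ne_zero Real.pi_pos.ne' (ne_of_gt ht)
  exact Complex.continuous_im.comp (Continuous.mul (by fun_prop) continuous_charFun)

lemma intervalIntegrable_inversionKernel (ξ : ℝ) {a b : ℝ} (ha : 0 < a) (hb : 0 < b) :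
    IntervalIntegrable (inversionKernel μ ξ) volume a b :=
  ((continuousOn_inversionKernel ξ).mono fun _ ht =>
    lt_of_lt_of_le (lt_min ha hb) ht.1).intervalIntegrable

/-- A primitive of the inversion kernel on `(0, ∞)`, which vanishes at `0`. -/
def inversionPrimitive (μ : Measure ℝ) (ξ T : ℝ) : ℝ :=
  (∫ x, sineIntegral ((x - ξ) * T) ∂μ) / Real.pi

lemma integrable_sineIntegral_mul (ξ T : ℝ) :
    Integrable (fun x => sineIntegral ((x - ξ) * T)) μ :=
  (integrable_const (4 : ℝ)).mono'
    (continuous_sineIntegral.comp (by fun_prop)).aestronglyMeasurable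
    (ae_of_all _ fun _ => abs_sineIntegral_le _)

lemma integral_sin_mul_div (c : ℝ) {a b : ℝ} (ha : 0 < a) (hb : 0 < b) :
    ∫ t in a..b, Real.sin (c * t) / (Real.pi * t) =
      (sineIntegral (c * b) - sineIntegral (c * a)) / Real.pi := by
  have h1 : ∀ t ∈ uIcc a b, Real.sin (c * t) / (Real.pi * t) =
      (c * Real.sinc (c * t)) / Real.pi := by
    intro t ht
    have ht0 : 0 < t := lt_of_lt_of_le (lt_min ha hb) ht.1
    rcases eq_or_ne c 0 with rfl | hc
    · simp
    · rw [Real.sinc_of_ne_zero (mul_ne_zero hc ht0.ne')]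
      field_simp
  have hi : ∀ s t, IntervalIntegrable Real.sinc volume s t := fun s t =>
    Real.continuous_sinc.intervalIntegrable _ _
  rw [intervalIntegral.integral_congr h1, intervalIntegral.integral_div,
    intervalIntegral.integral_const_mul, ← smul_eq_mul,
    intervalIntegral.smul_integral_comp_mul_left, sineIntegral, sineIntegral,
    intervalIntegral.integral_interval_sub_left (hi _ _) (hi _ _)]

/-- Fubini's theorem; on a compact interval away from `0` the integrand
`sin ((x - ξ) t) / (πt)` is bounded. -/
lemma integral_inversionKernel (ξ : ℝ) {a b : ℝ} (ha : 0 < a) (hb : 0 < b) :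
    ∫ t in a..b, inversionKernel μ ξ t = inversionPrimitive μ ξ b - inversionPrimitive μ ξ a := by
  have hmin : 0 < min a b := lt_min ha hb
  have hint : Integrable (Function.uncurry fun t x : ℝ =>
      Real.sin ((x - ξ) * t) / (Real.pi * t)) ((volume.restrict (uIoc a b)).prod μ) := by
    have hc : Integrable (fun _ : ℝ × ℝ => 1 / (Real.pi * min a b))
        ((volume.restrict (uIoc a b)).prod μ) := by
      have : IsFiniteMeasure ((volume : Measure ℝ).restrict (uIoc a b)) :=
        ⟨by simp [uIoc]⟩
      exact integrable_const _
    refine hc.mono' (Measurable.aestronglyMeasurable (by unfold Function.uncurry; fun_prop)) ?_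
    have hae : ∀ᵐ p : ℝ × ℝ ∂((volume.restrict (uIoc a b)).prod μ), p.1 ∈ uIoc a b :=
      Measure.quasiMeasurePreserving_fst.ae (ae_restrict_mem measurableSet_uIoc)
    filter_upwards [hae] with p hp
    have hp1 : min a b < p.1 := hp.1
    simp only [Function.uncurry]
    rw [norm_div, Real.norm_eq_abs, Real.norm_eq_abs,
      abs_of_pos (mul_pos Real.pi_pos (hmin.trans hp1))]
    have := Real.pi_pos
    gcongr
    exact Real.abs_sin_le_one _
  calc ∫ t in a..b, inversionKernel μ ξ t
      = ∫ t in a..b, ∫ x, Real.sin ((x - ξ) * t) / (Real.pi * t) ∂μ := by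
        refine intervalIntegral.integral_congr fun t _ => ?_
        rw [inversionKernel_eq_integral, integral_div]
    _ = ∫ x, (∫ t in a..b, Real.sin ((x - ξ) * t) / (Real.pi * t)) ∂μ :=
        intervalIntegral_integral_swap hint
    _ = ∫ x, (sineIntegral ((x - ξ) * b) - sineIntegral ((x - ξ) * a)) / Real.pi ∂μ := by
        simp_rw [integral_sin_mul_div _ ha hb]
    _ = _ := by
        rw [integral_div, integral_sub (integrable_sineIntegral_mul ξ b)
          (integrable_sineIntegral_mul ξ a), inversionPrimitive, inversionPrimitive, sub_div]

lemma tendsto_inversionPrimitive_of_tendsto {l : Filter ℝ} [l.IsCountablyGenerated] {ξ : ℝ}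
    {g : ℝ → ℝ} (h : ∀ x, Tendsto (fun T => sineIntegral ((x - ξ) * T)) l (𝓝 (g x))) :
    Tendsto (inversionPrimitive μ ξ) l (𝓝 ((∫ x, g x ∂μ) / Real.pi)) := by
  refine Tendsto.div_const ?_ _
  exact tendsto_integral_filter_of_dominated_convergence (fun _ => (4 : ℝ))
    (Eventually.of_forall fun T => (integrable_sineIntegral_mul ξ T).aestronglyMeasurable)
    (Eventually.of_forall fun T => ae_of_all _ fun x => abs_sineIntegral_le _)
    (integrable_const _) (ae_of_all _ h)

lemma tendsto_inversionPrimitive_zero (ξ : ℝ) :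
    Tendsto (inversionPrimitive μ ξ) (𝓝[>] 0) (𝓝 0) := by
  have h := tendsto_inversionPrimitive_of_tendsto (μ := μ) (ξ := ξ) (l := 𝓝[>] 0)
    (g := fun _ => 0) fun x => by
      have hc : Continuous fun T => sineIntegral ((x - ξ) * T) :=
        continuous_sineIntegral.comp (by fun_prop)
      have := (hc.tendsto 0).mono_left (nhdsWithin_le_nhds (s := Ioi 0))
      simpa [sineIntegral_zero] using this
  simpa using h

/-- The mean `(F(ξ) + F(ξ-)) / 2` of the one-sided limits of the distribution function of `μ`. -/
def cdfMid (μ : Measure ℝ) (ξ : ℝ) : ℝ := (cdf μ ξ + Function.leftLim (cdf μ) ξ) / 2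

lemma leftLim_cdf (ξ : ℝ) : Function.leftLim (cdf μ) ξ = μ.real (Iio ξ) := by
  have h := (cdf μ).measure_Iio (tendsto_cdf_atBot μ) ξ
  rw [measure_cdf, sub_zero] at h
  have h0 : 0 ≤ Function.leftLim (cdf μ) ξ :=
    (cdf_nonneg μ (ξ - 1)).trans ((monotone_cdf μ).le_leftLim (by linarith))
  rw [Measure.real, h, ENNReal.toReal_ofReal h0]

lemma integral_sign_sub (ξ : ℝ) : ∫ x, Real.sign (x - ξ) ∂μ = 1 - 2 * cdfMid μ ξ := by
  have h1 : (fun x => Real.sign (x - ξ)) = fun x => 1 - (Iic ξ).indicator (fun _ => (1 : ℝ)) x -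
      (Iio ξ).indicator (fun _ => (1 : ℝ)) x := by
    funext x
    rcases lt_trichotomy x ξ with h | h | h
    · rw [Real.sign_of_neg (sub_neg.2 h)]
      simp [h, h.le]
    · simp [h]
    · rw [Real.sign_of_pos (sub_pos.2 h)]
      simp [h, h.le]
  have hi1 : Integrable ((Iic ξ).indicator fun _ => (1 : ℝ)) μ :=
    (integrable_const _).indicator measurableSet_Iic
  have hi2 : Integrable ((Iio ξ).indicator fun _ => (1 : ℝ)) μ :=
    (integrable_const _).indicator measurableSet_Iio
  have hi3 : Integrable (fun x => 1 - (Iic ξ).indicator (fun _ => (1 : ℝ)) x) μ :=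
    (integrable_const _).sub hi1
  rw [h1, integral_sub hi3 hi2, integral_sub (integrable_const _) hi1,
    integral_indicator_const _ measurableSet_Iic, integral_indicator_const _ measurableSet_Iio,
    cdfMid, leftLim_cdf, cdf_eq_real]
  simp
  ring

lemma tendsto_inversionPrimitive_atTop (ξ : ℝ) :
    Tendsto (inversionPrimitive μ ξ) atTop (𝓝 (1 / 2 - cdfMid μ ξ)) := by
  have h := tendsto_inversionPrimitive_of_tendsto (μ := μ) fun x => tendsto_sineIntegral_mul (x - ξ)
  rw [integral_const_mul, integral_sign_sub] at h
  convert! h using 2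
  have := Real.pi_pos
  field_simp

/-- The inversion formula of Gil-Pelaez, with improper integrals at both ends. -/
lemma tendsto_integral_inversionKernel (ξ : ℝ) :
    Tendsto (fun p : ℝ × ℝ => ∫ t in p.1..p.2, inversionKernel μ ξ t) (𝓝[>] 0 ×ˢ atTop)
      (𝓝 (1 / 2 - cdfMid μ ξ)) := by
  have h := ((tendsto_inversionPrimitive_atTop (μ := μ) ξ).comp
    (tendsto_snd (f := 𝓝[>] (0 : ℝ)) (g := atTop))).sub
    ((tendsto_inversionPrimitive_zero (μ := μ) ξ).comp
    (tendsto_fst (f := 𝓝[>] (0 : ℝ)) (g := atTop)))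
  rw [sub_zero] at h
  refine h.congr' ?_
  filter_upwards [Filter.Eventually.prod_mk (self_mem_nhdsWithin : Ioi (0 : ℝ) ∈ 𝓝[>] (0 : ℝ))
    (eventually_gt_atTop (0 : ℝ))] with p hp
  exact (integral_inversionKernel ξ hp.1 hp.2).symm

lemma cdfMid_eq_cdf {ξ : ℝ} (h : μ {ξ} = 0) : cdfMid μ ξ = cdf μ ξ := by
  have h1 : μ.real (Iio ξ) = μ.real (Iic ξ) := by
    rw [Measure.real, Measure.real, measure_congr (Iio_ae_eq_Iic' h)]
  rw [cdfMid, leftLim_cdf, cdf_eq_real, h1]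
  ring

end Inversion

/-! ### Fourier transforms of `Psi` -/

lemma Psi_top (μ : Measure ℝ) (R : ℝ) : Psi μ ⊤ R = 0 := by
  funext t
  simp [Psi]

lemma Psi_coe (μ : Measure ℝ) (s r : ℝ) :
    Psi μ s r = {t : ℝ | s ≤ |t| ∧ |t| ≤ r}.indicator
      fun t => charFun μ t / (Complex.I * 2 * Real.pi * t) := by
  funext t
  simp [Psi, indicator_apply, EReal.coe_le_coe_iff]

section FourierPsi

variable {μ : Measure ℝ} [IsProbabilityMeasure μ]

lemma integrable_Psi_coe {s : ℝ} (hs : 0 < s) (r : ℝ) : Integrable (Psi μ s r) := by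
  have hmeas : MeasurableSet {t : ℝ | s ≤ |t| ∧ |t| ≤ r} :=
    (measurableSet_le measurable_const measurable_norm).inter
      (measurableSet_le measurable_norm measurable_const)
  rw [Psi_coe, integrable_indicator_iff hmeas]
  have hfin : volume {t : ℝ | s ≤ |t| ∧ |t| ≤ r} ≠ ⊤ :=
    ((measure_mono fun t ht => (abs_le.1 ht.2 : t ∈ Icc (-r) r)).trans_lt
      measure_Icc_lt_top).ne
  refine Measure.integrableOn_of_bounded (M := 1 / (2 * Real.pi * s)) hfin
    (Measurable.aestronglyMeasurable (measurable_charFun.div (by fun_prop))) ?_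
  filter_upwards [ae_restrict_mem hmeas] with t ht
  have h2 : ‖Complex.I * 2 * Real.pi * t‖ = 2 * Real.pi * |t| := by
    simp [abs_of_pos Real.pi_pos]
  rw [norm_div, h2]
  have := Real.pi_pos
  have := norm_charFun_le_one (μ := μ) t
  have := ht.1
  gcongr

lemma integrable_Psi {S : EReal} (hS : 0 < S) (r : ℝ) : Integrable (Psi μ S r) := by
  induction S with
  | bot => simp at hS
  | top => rw [Psi_top]; exact integrable_zero _ _ _
  | coe s => exact integrable_Psi_coe (by exact_mod_cast hS) r

/-- The contributions of `t` and `-t` combine into the real inversion kernel. -/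
lemma fourierTransform_Psi_coe {s : ℝ} (hs : 0 < s) (r ξ : ℝ) :
    fourierTransform (Psi μ s r) (-ξ) = ((∫ t in Icc s r, inversionKernel μ ξ t : ℝ) : ℂ) := by
  set u : ℝ → ℂ := fun x => Complex.exp (Complex.I * (-ξ : ℝ) * x) * Psi μ s r x with hu
  have hint : Integrable u := by
    refine (integrable_Psi_coe (μ := μ) hs r).bdd_mul (c := 1)
      (Continuous.aestronglyMeasurable (by fun_prop)) (ae_of_all _ fun x => ?_)
    have : Complex.I * (-ξ : ℝ) * x = ((-ξ * x : ℝ) : ℂ) * Complex.I := by push_cast; ring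
    rw [this, Complex.norm_exp_ofReal_mul_I]
  have hneg := integral_comp_neg_Ioi 0 u
  rw [neg_zero] at hneg
  -- With `z = e^{-iξt} Φ(t)`, the two terms are `z / (2πit)` and `-(conj z) / (2πit)`.
  have hsum : ∀ t ∈ Ioi (0 : ℝ), u (-t) + u t =
      (Icc s r).indicator (fun t => (inversionKernel μ ξ t : ℂ)) t := by
    intro t ht
    have ht : 0 < t := ht
    simp only [hu, Psi_coe, indicator_apply, mem_ofPred_eq, abs_neg, abs_of_pos ht, mem_Icc]
    split_ifs with h
    · set z : ℂ := Complex.exp (-(ξ * t) * Complex.I) * charFun μ t with hz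
      have h1 : Complex.exp (Complex.I * (-ξ : ℝ) * t) * charFun μ t = z := by
        rw [hz]; push_cast; ring_nf
      have h2 : Complex.exp (Complex.I * (-ξ : ℝ) * (-t : ℝ)) * charFun μ (-t) =
          (starRingEnd ℂ) z := by
        rw [hz, map_mul, ← Complex.exp_conj, charFun_neg]
        simp
        left; ring_nf
      rw [mul_div_assoc', mul_div_assoc', h1, h2, inversionKernel, ← hz]
      have h3 : z - (starRingEnd ℂ) z = 2 * z.im * Complex.I := by
        rw [Complex.sub_conj]; push_cast; ring
      have hpi : (Real.pi : ℂ) ≠ 0 := by exact_mod_cast Real.pi_pos.ne'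
      have ht' : (t : ℂ) ≠ 0 := by exact_mod_cast ht.ne'
      have hcomb : (starRingEnd ℂ) z / (Complex.I * 2 * Real.pi * ((-t : ℝ) : ℂ)) +
          z / (Complex.I * 2 * Real.pi * t) =
          (z - (starRingEnd ℂ) z) / (Complex.I * 2 * Real.pi * t) := by
        push_cast
        rw [mul_neg, div_neg]; ring
      rw [hcomb, h3]
      push_cast
      field_simp
    · simp
  have h0 : Ioi (0 : ℝ) ∩ Icc s r = Icc s r :=
    inter_eq_right.2 fun t ht => lt_of_lt_of_le hs ht.1
  calc fourierTransform (Psi μ s r) (-ξ) = ∫ x, u x := rfl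
    _ = (∫ x in Iic 0, u x) + ∫ x in Ioi 0, u x :=
        (intervalIntegral.integral_Iic_add_Ioi hint.integrableOn hint.integrableOn).symm
    _ = ∫ t in Ioi 0, (u (-t) + u t) := by
        rw [← hneg, integral_add hint.comp_neg.integrableOn hint.integrableOn]
    _ = ∫ t in Ioi 0, (Icc s r).indicator (fun t => (inversionKernel μ ξ t : ℂ)) t :=
        setIntegral_congr_fun measurableSet_Ioi hsum
    _ = _ := by
        rw [setIntegral_indicator measurableSet_Icc, h0]
        exact integral_ofReal

lemma fourierTransform_Psi_top (μ : Measure ℝ) (r ξ : ℝ) :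
    fourierTransform (Psi μ ⊤ r) (-ξ) = 0 := by
  simp [fourierTransform, Psi_top]

lemma tendsto_setIntegral_Icc_inversionKernel {s : ℝ} (hs : 0 < s) (ξ : ℝ) :
    Tendsto (fun R : ℝ => ∫ t in Icc s R, inversionKernel μ ξ t) atTop
      (𝓝 (1 / 2 - cdfMid μ ξ - inversionPrimitive μ ξ s)) := by
  refine ((tendsto_inversionPrimitive_atTop ξ).sub_const _).congr' ?_
  filter_upwards [eventually_ge_atTop s] with R hR
  rw [integral_Icc_eq_integral_Ioc, ← intervalIntegral.integral_of_le hR,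
    integral_inversionKernel ξ hs (hs.trans_le hR)]

lemma exists_tendsto_fourierTransform_Psi {S : EReal} (hS : 0 < S) (ξ : ℝ) :
    ∃ v : ℂ, Tendsto (fun R : ℝ => fourierTransform (Psi μ S R) (-ξ)) atTop (𝓝 v) := by
  induction S with
  | bot => simp at hS
  | top => exact ⟨0, by simp only [fourierTransform_Psi_top]; exact tendsto_const_nhds⟩
  | coe s =>
    have hs : 0 < s := by exact_mod_cast hS
    simp only [fourierTransform_Psi_coe hs]
    exact ⟨_, (Complex.continuous_ofReal.tendsto _).comp
      (tendsto_setIntegral_Icc_inversionKernel hs ξ)⟩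

lemma intervalIntegral_indicator_eq {A B : Set ℝ} {f : ℝ → ℝ} {a b : ℝ} (hab : a ≤ b)
    (hA : MeasurableSet A) (h : Ioc a b ∩ A = B) :
    ∫ t in a..b, A.indicator f t = ∫ t in B, f t := by
  rw [intervalIntegral.integral_of_le hab, setIntegral_indicator hA, h]

lemma measurableSet_coe_mem_Icc (S S' : EReal) :
    MeasurableSet {t : ℝ | (t : EReal) ∈ Icc S S'} :=
  measurable_coe_real_ereal measurableSet_Icc

/-- The number `fourierPsi μ S S' (-ξ)` is the improper integral of the inversion kernel
over `[S, S']`. In particular the limit hidden in its definition for `S' = ∞` exists. -/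
lemma exists_tendsto_integral_indicator {S S' : EReal} (hS : 0 < S) (hSS' : S ≤ S') (ξ : ℝ) :
    ∃ v : ℝ, fourierPsi μ S S' (-ξ) = v ∧
      Tendsto (fun p : ℝ × ℝ => ∫ t in p.1..p.2,
        {t : ℝ | (t : EReal) ∈ Icc S S'}.indicator (inversionKernel μ ξ) t)
        (𝓝[>] 0 ×ˢ atTop) (𝓝 v) := by
  have hm := measurableSet_coe_mem_Icc S S'
  induction S with
  | bot => simp at hS
  | top =>
    obtain rfl : S' = ⊤ := top_le_iff.1 hSS'
    refine ⟨0, ?_, ?_⟩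
    · simp only [fourierPsi, fourierTransform_Psi_top]
      exact tendsto_const_nhds.limUnder_eq
    · simp
  | coe s =>
    have hs : 0 < s := by exact_mod_cast hS
    induction S' with
    | bot => simp at hSS'
    | top =>
      have ht := tendsto_setIntegral_Icc_inversionKernel (μ := μ) hs ξ
      refine ⟨_, ?_, (ht.comp (tendsto_snd (f := 𝓝[>] (0 : ℝ)))).congr' ?_⟩
      · simp only [fourierPsi, fourierTransform_Psi_coe hs]
        exact ((Complex.continuous_ofReal.tendsto _).comp ht).limUnder_eq
      · filter_upwards [Filter.Eventually.prod_mk (Ioo_mem_nhdsGT hs) (eventually_gt_atTop s)]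
          with p hp
        refine (intervalIntegral_indicator_eq (hp.1.2.trans hp.2).le hm ?_).symm
        ext t
        simp only [mem_inter_iff, mem_Ioc, mem_ofPred_eq, mem_Icc, EReal.coe_le_coe_iff, le_top]
        exact ⟨fun h => ⟨h.2.1, h.1.2⟩, fun h => ⟨⟨hp.1.2.trans_le h.1, h.2⟩, h.1, trivial⟩⟩
    | coe r =>
      refine ⟨∫ t in Icc s r, inversionKernel μ ξ t, fourierTransform_Psi_coe hs r ξ,
        tendsto_const_nhds.congr' ?_⟩
      · filter_upwards [Filter.Eventually.prod_mk (Ioo_mem_nhdsGT hs)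
          (eventually_gt_atTop (max s r))] with p hp
        refine (intervalIntegral_indicator_eq
          (hp.1.2.trans ((le_max_left _ _).trans_lt hp.2)).le hm ?_).symm
        ext t
        simp only [mem_inter_iff, mem_Ioc, mem_ofPred_eq, mem_Icc, EReal.coe_le_coe_iff]
        exact ⟨fun h => h.2, fun h => ⟨⟨hp.1.2.trans_le h.1,
          h.2.trans ((le_max_right s r).trans hp.2.le)⟩, h⟩⟩

lemma fourierPsi_eq_zero_of_null {S S' : EReal} (hS : 0 < S) (hSS' : S ≤ S') (ξ : ℝ)
    (h0 : volume {t : ℝ | (t : EReal) ∈ Icc S S'} = 0) : fourierPsi μ S S' (-ξ) = 0 := by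
  obtain ⟨v, hv, ht⟩ := exists_tendsto_integral_indicator (μ := μ) hS hSS' ξ
  have hz : ∀ p : ℝ × ℝ, ∫ t in p.1..p.2,
      {t : ℝ | (t : EReal) ∈ Icc S S'}.indicator (inversionKernel μ ξ) t = 0 := fun p => by
    refine intervalIntegral.integral_zero_ae ?_
    filter_upwards [measure_eq_zero_iff_ae_notMem.1 h0] with t ht _
    exact indicator_of_notMem (show t ∉ {t : ℝ | (t : EReal) ∈ Icc S S'} from ht) _
  simp only [hz] at ht
  rw [hv, tendsto_nhds_unique ht tendsto_const_nhds, Complex.ofReal_zero]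

end FourierPsi

/-! ### The symmetrized laws -/

section Laws

variable (μX με μη ν : Measure ℝ) [IsProbabilityMeasure με] [IsProbabilityMeasure μη]
  [IsProbabilityMeasure ν]

instance : IsProbabilityMeasure (μη.map fun x => -x) :=
  Measure.isProbabilityMeasure_map (by fun_prop)

instance : IsProbabilityMeasure (symmError με μη) := by
  unfold symmError; infer_instance

instance isProbabilityMeasure_convPow (k : ℕ) : IsProbabilityMeasure (convPow ν k) := by
  induction k with
  | zero => unfold convPow; infer_instance
  | succ k ih => unfold convPow; infer_instance

lemma symmObs_conv_convPow [SFinite μX] (k : ℕ) :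
    (symmObs μX με μη).conv (convPow (symmError με μη) k) =
      μX.conv (convPow (symmError με μη) (k + 1)) := by
  have h : symmObs μX με μη = μX.conv (symmError με μη) := Measure.conv_assoc _ _ _
  rw [h, Measure.conv_assoc, convPow]

lemma charFun_convPow (k : ℕ) (t : ℝ) : charFun (convPow ν k) t = charFun ν t ^ k := by
  induction k with
  | zero => simp [convPow]
  | succ k ih => rw [convPow, charFun_conv, ih, pow_succ']

variable {ν}

lemma inversionKernel_conv_convPow [IsFiniteMeasure μX] (hν : ∀ t, (charFun ν t).im = 0)
    (k : ℕ) (ξ t : ℝ) :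
    inversionKernel (μX.conv (convPow ν k)) ξ t =
      (charFun ν t).re ^ k * inversionKernel μX ξ t := by
  have h : charFun ν t = ((charFun ν t).re : ℂ) := Complex.ext rfl (by simp [hν t])
  rw [inversionKernel, charFun_conv, charFun_convPow, inversionKernel, h, ← mul_assoc,
    ← Complex.ofReal_pow, Complex.im_mul_ofReal, Complex.ofReal_re]
  ring

end Laws

/-! ### Powers of the characteristic function -/

/-- The polynomial identity that turns the binomial sum defining `𝔇(ξ, m)` into the `m`-power. -/
lemma sum_choose_mul_pow_succ (x : ℝ) (m : ℕ) :
    ∑ l ∈ Finset.range (m + 1), ∑ k ∈ Finset.range (l + 1),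
      (l.choose k : ℝ) * (-1) ^ k * x ^ (k + 1) = 1 - (1 - x) ^ (m + 1) := by
  have h : ∀ l : ℕ, ∑ k ∈ Finset.range (l + 1), (l.choose k : ℝ) * (-1) ^ k * x ^ (k + 1) =
      x * (1 - x) ^ l := by
    intro l
    rw [sub_eq_neg_add, add_pow, Finset.mul_sum]
    refine Finset.sum_congr rfl fun k _ => ?_
    rw [neg_pow x, one_pow]
    ring
  simp_rw [h]
  rw [← Finset.mul_sum]
  have := mul_neg_geom_sum (1 - x) (m + 1)
  rw [sub_sub_cancel] at this
  exact this

lemma mPower_mem_Icc {ν : Measure ℝ} [IsProbabilityMeasure ν]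
    (h0 : ∀ t, 0 ≤ (charFun ν t).re) (t : ℝ) : 1 - (charFun ν t).re ∈ Icc (0 : ℝ) 1 := by
  have h1 := (Complex.re_le_norm _).trans (norm_charFun_le_one (μ := ν) t)
  exact ⟨by linarith, by linarith [h0 t]⟩

lemma continuous_mPower {ν : Measure ℝ} [IsProbabilityMeasure ν] (m : ℕ) :
    Continuous (mPower ν m) :=
  (continuous_const.sub (Complex.continuous_re.comp continuous_charFun)).pow _

lemma abs_mPower_le_one {ν : Measure ℝ} [IsProbabilityMeasure ν]
    (h0 : ∀ t, 0 ≤ (charFun ν t).re) (m : ℕ) (t : ℝ) : |mPower ν m t| ≤ 1 := by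
  have h := mPower_mem_Icc h0 t
  rw [mPower, abs_of_nonneg (pow_nonneg h.1 _)]
  exact pow_le_one₀ h.1 h.2

lemma tendsto_mPower {ν : Measure ℝ} [IsProbabilityMeasure ν]
    (him : ∀ t, (charFun ν t).im = 0) (h0 : ∀ t, 0 ≤ (charFun ν t).re) (t : ℝ) :
    Tendsto (fun m => mPower ν m t) atTop
      (𝓝 ({t : ℝ | (t : EReal) ∈ zeroSet ν}.indicator (fun _ => 1) t)) := by
  have h := mPower_mem_Icc h0 t
  by_cases ht : charFun ν t = 0
  · rw [indicator_of_mem (show t ∈ {t : ℝ | (t : EReal) ∈ zeroSet ν} from ht)]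
    simp [mPower, ht]
  · rw [indicator_of_notMem (show t ∉ {t : ℝ | (t : EReal) ∈ zeroSet ν} from ht)]
    refine (tendsto_pow_atTop_nhds_zero_of_lt_one h.1 ?_).comp (tendsto_add_atTop_nat 1)
    have : (charFun ν t).re ≠ 0 := fun hre => ht (Complex.ext hre (him t))
    have := lt_of_le_of_ne (h0 t) this.symm
    linarith

lemma eVariationOn_mPower_le {ν : Measure ℝ} (m : ℕ) :
    eVariationOn (mPower ν m) (Ioi 0) ≤ eVariationOn (mPowerExt ν m) (Icc (0 : EReal) ⊤) :=
  eVariationOn.comp_le_of_monotoneOn (mPowerExt ν m) (fun t : ℝ => (t : EReal))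
    (fun _ _ _ _ h => EReal.coe_le_coe_iff.2 h)
    (fun _ ht => ⟨EReal.coe_nonneg.2 (le_of_lt ht), le_top⟩)

/-- By inversion, the distance of `𝔇(ξ, m)` from the midpoint of the jump of `F_X` at `ξ` is
the improper integral of the inversion kernel of `F_X` against the `m`-power. -/
lemma tendsto_integral_mPower_mul (μX με μη : Measure ℝ)
    [IsProbabilityMeasure μX] [IsProbabilityMeasure με] [IsProbabilityMeasure μη]
    (him : ∀ t, (charFun (symmError με μη) t).im = 0) {ξ : ℝ} (hξ : ξ ∉ atomSet μX με μη)
    (m : ℕ) :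
    Tendsto (fun p : ℝ × ℝ => ∫ t in p.1..p.2,
        mPower (symmError με μη) m t * inversionKernel μX ξ t) (𝓝[>] 0 ×ˢ atTop)
      (𝓝 (deconvFun μX με μη ξ m - cdfMid μX ξ)) := by
  set ν := symmError με μη with hν
  have hcdf : ∀ k : ℕ, Tendsto (fun p : ℝ × ℝ => 1 / 2 - ∫ t in p.1..p.2,
      (charFun ν t).re ^ (k + 1) * inversionKernel μX ξ t) (𝓝[>] 0 ×ˢ atTop)
      (𝓝 (cdf ((symmObs μX με μη).conv (convPow ν k)) ξ)) := by
    intro k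
    have hat : (μX.conv (convPow ν (k + 1))) {ξ} = 0 := by
      by_contra h
      exact hξ ⟨k + 1, by omega, pos_iff_ne_zero.2 h⟩
    have h := (tendsto_integral_inversionKernel (μ := μX.conv (convPow ν (k + 1))) ξ).const_sub
      (1 / 2)
    simp only [inversionKernel_conv_convPow μX him, cdfMid_eq_cdf hat, sub_sub_cancel] at h
    rw [symmObs_conv_convPow]
    exact h
  have hD : Tendsto (fun p : ℝ × ℝ => ∑ l ∈ Finset.range (m + 1), ∑ k ∈ Finset.range (l + 1),
      (l.choose k : ℝ) * (-1) ^ k * (1 / 2 - ∫ t in p.1..p.2,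
        (charFun ν t).re ^ (k + 1) * inversionKernel μX ξ t)) (𝓝[>] 0 ×ˢ atTop)
      (𝓝 (deconvFun μX με μη ξ m)) :=
    tendsto_finsetSum _ fun l _ => tendsto_finsetSum _ fun k _ => (hcdf k).const_mul _
  have hsub := (hD.sub (tendsto_const_nhds (x := (1 / 2 : ℝ)))).add
    (tendsto_integral_inversionKernel (μ := μX) ξ)
  have hlim : deconvFun μX με μη ξ m - 1 / 2 + (1 / 2 - cdfMid μX ξ) =
      deconvFun μX με μη ξ m - cdfMid μX ξ := by ring
  rw [hlim] at hsub
  refine hsub.congr' ?_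
  filter_upwards [Filter.Eventually.prod_mk (self_mem_nhdsWithin : Ioi (0 : ℝ) ∈ 𝓝[>] (0 : ℝ))
    (eventually_gt_atTop (0 : ℝ))] with p hp
  have hI := intervalIntegrable_inversionKernel (μ := μX) ξ hp.1 hp.2
  have hpow : ∀ k : ℕ, IntervalIntegrable
      (fun t => (charFun ν t).re ^ (k + 1) * inversionKernel μX ξ t) volume p.1 p.2 := fun k =>
    hI.continuousOn_mul ((Complex.continuous_re.comp continuous_charFun).pow _).continuousOn
  have hpowsum : ∀ l : ℕ, IntervalIntegrable (fun t => ∑ k ∈ Finset.range (l + 1),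
      (l.choose k : ℝ) * (-1) ^ k * ((charFun ν t).re ^ (k + 1) * inversionKernel μX ξ t))
      volume p.1 p.2 := fun l => by
    simpa only [Finset.sum_fn] using IntervalIntegrable.sum _
      fun k (_ : k ∈ Finset.range (l + 1)) => (hpow k).const_mul ((l.choose k : ℝ) * (-1) ^ k)
  -- The coefficients of `𝔇(ξ, m)` add up to `1`: the binomial identity at `x = 1`.
  have hone := sum_choose_mul_pow_succ 1 m
  simp only [one_pow, mul_one, sub_self, ne_eq, Nat.succ_ne_zero, not_false_eq_true, zero_pow,
    sub_zero] at hone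
  have hsplit : ∑ l ∈ Finset.range (m + 1), ∑ k ∈ Finset.range (l + 1),
      (l.choose k : ℝ) * (-1) ^ k * (1 / 2 - ∫ t in p.1..p.2,
        (charFun ν t).re ^ (k + 1) * inversionKernel μX ξ t) =
      1 / 2 - ∫ t in p.1..p.2, (1 - mPower ν m t) * inversionKernel μX ξ t := by
    have e1 : ∫ t in p.1..p.2, (1 - mPower ν m t) * inversionKernel μX ξ t =
        ∑ l ∈ Finset.range (m + 1), ∑ k ∈ Finset.range (l + 1),
          (l.choose k : ℝ) * (-1) ^ k * ∫ t in p.1..p.2,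
            (charFun ν t).re ^ (k + 1) * inversionKernel μX ξ t := by
      simp_rw [← intervalIntegral.integral_const_mul]
      simp_rw [← intervalIntegral.integral_finsetSum
        (fun k (_ : k ∈ Finset.range (_ + 1)) => (hpow k).const_mul _)]
      rw [← intervalIntegral.integral_finsetSum (fun l _ => hpowsum l)]
      refine intervalIntegral.integral_congr fun t _ => ?_
      simp only [mPower]
      rw [← sum_choose_mul_pow_succ, Finset.sum_mul]
      refine Finset.sum_congr rfl fun l _ => ?_
      rw [Finset.sum_mul]
      exact Finset.sum_congr rfl fun k _ => by ring
    rw [e1]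
    simp_rw [mul_sub, Finset.sum_sub_distrib]
    simp_rw [← Finset.sum_mul]
    rw [hone, one_mul]
  have hmP : IntervalIntegrable (fun t => mPower ν m t * inversionKernel μX ξ t) volume p.1 p.2 :=
    hI.continuousOn_mul (continuous_mPower m).continuousOn
  have e2 : ∫ t in p.1..p.2, (1 - mPower ν m t) * inversionKernel μX ξ t =
      (∫ t in p.1..p.2, inversionKernel μX ξ t) -
        ∫ t in p.1..p.2, mPower ν m t * inversionKernel μX ξ t := by
    rw [← intervalIntegral.integral_sub hI hmP]
    exact intervalIntegral.integral_congr fun t _ => by ring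
  rw [hsplit, e2]
  ring

/-! ### Decomposition of the zero set into intervals -/

section Intervals

variable {N : Set EReal} {K : ℕ} {τ : ℕ → EReal}

lemma IsIntervalDecomp.le (hτ : IsIntervalDecomp N K τ) {i j : ℕ} (hi : 1 ≤ i) (hij : i ≤ j)
    (hj : j ≤ 2 * K) : τ i ≤ τ j := by
  induction j, hij using Nat.le_induction with
  | base => exact le_rfl
  | succ j hij ih =>
    refine (ih (by omega)).trans ?_
    rcases Nat.even_or_odd j with h | h
    · exact (hτ.even j (by omega) hj h).le
    · exact (hτ.odd j (by omega) (by omega) h).1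

lemma IsIntervalDecomp.pairwiseDisjoint (hτ : IsIntervalDecomp N K τ) :
    (Finset.Icc 1 K : Set ℕ).PairwiseDisjoint fun k => Icc (τ (2 * k - 1)) (τ (2 * k)) := by
  have key : ∀ k l, 1 ≤ k → k < l → l ≤ K →
      Disjoint (Icc (τ (2 * k - 1)) (τ (2 * k))) (Icc (τ (2 * l - 1)) (τ (2 * l))) := by
    intro k l hk hkl hl
    rw [Set.disjoint_left]
    intro t ht ht'
    have h1 := hτ.even (2 * k) (by omega) (by omega) (even_two_mul k)
    have h2 := hτ.le (i := 2 * k + 1) (j := 2 * l - 1) (by omega) (by omega) (by omega)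
    exact absurd (ht'.1.trans ht.2) (not_le.2 (h1.trans_le h2))
  intro k hk l hl hkl
  rw [Finset.mem_coe, Finset.mem_Icc] at hk hl
  rcases lt_or_gt_of_ne hkl with h | h
  · exact key k l hk.1 h hl.2
  · exact (key l k hl.1 h hk.2).symm

lemma IsIntervalDecomp.Icc_subset (hτ : IsIntervalDecomp N K τ) {k : ℕ}
    (hk : k ∈ Finset.Icc 1 K) : Icc (τ (2 * k - 1)) (τ (2 * k)) ⊆ N := by
  rw [Finset.mem_Icc] at hk
  have h := (hτ.odd (2 * k - 1) (by omega) (by omega) ⟨k - 1, by omega⟩).2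
  rwa [show 2 * k - 1 + 1 = 2 * k by omega] at h

lemma IsIntervalDecomp.pos (hτ : IsIntervalDecomp N K τ) (h0 : (0 : EReal) ∉ N) {k : ℕ}
    (hk : k ∈ Finset.Icc 1 K) : 0 < τ (2 * k - 1) := by
  rw [Finset.mem_Icc] at hk
  have h := hτ.mem (2 * k - 1) (by omega) (by omega)
  exact lt_of_le_of_ne h.2.1 fun h' => h0 (h' ▸ h.1)

lemma IsIntervalDecomp.indicator_eq_sum (hτ : IsIntervalDecomp N K τ) (g : ℝ → ℝ) {t : ℝ}
    (ht : 0 < t) : {t : ℝ | (t : EReal) ∈ N}.indicator (fun _ => 1) t * g t =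
      ∑ k ∈ Finset.Icc 1 K,
        {t : ℝ | (t : EReal) ∈ Icc (τ (2 * k - 1)) (τ (2 * k))}.indicator g t := by
  have hmem : (t : EReal) ∈ N ↔
      t ∈ ⋃ k ∈ Finset.Icc 1 K, {t : ℝ | (t : EReal) ∈ Icc (τ (2 * k - 1)) (τ (2 * k))} := by
    have h : (t : EReal) ∈ N ↔ (t : EReal) ∈ N ∩ Icc 0 ⊤ :=
      ⟨fun h => ⟨h, EReal.coe_nonneg.2 ht.le, le_top⟩, fun h => h.1⟩
    rw [h, hτ.eq_iUnion]
    simp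
  rw [← Finset.indicator_biUnion_apply]
  · by_cases h : (t : EReal) ∈ N
    · rw [indicator_of_mem (hmem.1 h),
        indicator_of_mem (show t ∈ {t : ℝ | (t : EReal) ∈ N} from h), one_mul]
    · rw [indicator_of_notMem (fun h' => h (hmem.2 h')),
        indicator_of_notMem (show t ∉ {t : ℝ | (t : EReal) ∈ N} from h), zero_mul]
  · intro k hk l hl hkl
    exact (hτ.pairwiseDisjoint hk hl hkl).preimage _

end Intervals

lemma zero_notMem_zeroSet (μ : Measure ℝ) [IsProbabilityMeasure μ] : (0 : EReal) ∉ zeroSet μ := by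
  intro h
  have h' : charFun μ 0 = 0 := h
  simp at h'

end Deconv

end

theorem mainTheorem2 (μX με μη : Measure ℝ)
    [IsProbabilityMeasure μX] [IsProbabilityMeasure με] [IsProbabilityMeasure μη]
    (hη : Deconv.IsSymmetrizer με μη)
    (hlim : ∃ L : ℂ, Tendsto (charFun (Deconv.symmError με μη)) atTop (𝓝 L))
    (hvar : (⨆ m : ℕ, eVariationOn (Deconv.mPowerExt (Deconv.symmError με μη) m)
      (Set.Icc (0 : EReal) ⊤)) < ⊤)
    (K : ℕ) (τ : ℕ → EReal) (hτ : Deconv.IsIntervalDecomp (Deconv.zeroSet με) K τ) :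
    (∀ ξ : ℝ, ξ ∉ Deconv.atomSet μX με μη →
      (∀ k ∈ Finset.Icc 1 K,
        (∀ R : ℝ, Integrable (Deconv.Psi μX (τ (2 * k - 1)) R)) ∧
        ∃ v : ℂ, Tendsto
          (fun R : ℝ => Deconv.fourierTransform (Deconv.Psi μX (τ (2 * k - 1)) R) (-ξ))
          atTop (𝓝 v)) ∧
      Tendsto (fun m : ℕ => (Deconv.deconvFun μX με μη ξ m : ℂ)) atTop
        (𝓝 ((((cdf μX ξ + Function.leftLim (cdf μX) ξ) / 2 : ℝ) : ℂ) +
          ∑ k ∈ Finset.Icc 1 K, Deconv.fourierPsi μX (τ (2 * k - 1)) (τ (2 * k)) (-ξ))) ∧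
      (volume {t : ℝ | (t : EReal) ∈ Deconv.zeroSet με} = 0 →
        ∑ k ∈ Finset.Icc 1 K, Deconv.fourierPsi μX (τ (2 * k - 1)) (τ (2 * k)) (-ξ) = 0)) := by
  open Deconv in
  intro ξ hξ
  have hpos : ∀ k ∈ Finset.Icc 1 K, 0 < τ (2 * k - 1) := fun k hk =>
    hτ.pos (zero_notMem_zeroSet με) hk
  have hle : ∀ k ∈ Finset.Icc 1 K, τ (2 * k - 1) ≤ τ (2 * k) := fun k hk => by
    rw [Finset.mem_Icc] at hk
    exact hτ.le (by omega) (by omega) (by omega)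
  refine ⟨fun k hk => ⟨integrable_Psi (hpos k hk),
    exists_tendsto_fourierTransform_Psi (hpos k hk) ξ⟩, ?_, fun h0 => ?_⟩
  · choose! v hv hvt using fun k (hk : k ∈ Finset.Icc 1 K) =>
      exists_tendsto_integral_indicator (μ := μX) (hpos k hk) (hle k hk) ξ
    set ν := symmError με μη with hν
    have hJ' : Tendsto (fun p : ℝ × ℝ => ∫ t in p.1..p.2,
        {t : ℝ | (t : EReal) ∈ zeroSet ν}.indicator (fun _ => 1) t * inversionKernel μX ξ t)
        (𝓝[>] 0 ×ˢ atTop) (𝓝 (∑ k ∈ Finset.Icc 1 K, v k)) := by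
      rw [hη.zeroSet_eq]
      refine (tendsto_finsetSum _ hvt).congr' ?_
      filter_upwards [Filter.Eventually.prod_mk
        (self_mem_nhdsWithin : Ioi (0 : ℝ) ∈ 𝓝[>] (0 : ℝ))
        (eventually_gt_atTop (0 : ℝ))] with p hp
      rw [← intervalIntegral.integral_finsetSum]
      · refine intervalIntegral.integral_congr fun t ht => ?_
        exact (hτ.indicator_eq_sum _ (lt_of_lt_of_le (lt_min hp.1 hp.2) ht.1)).symm
      · intro k _
        have hI := intervalIntegrable_inversionKernel (μ := μX) ξ hp.1 hp.2
        exact ⟨hI.1.indicator (measurableSet_coe_mem_Icc _ _),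
          hI.2.indicator (measurableSet_coe_mem_Icc _ _)⟩
    have hmain := tendsto_of_tendsto_integral_mul (f := fun m => mPower ν m)
      (V := (⨆ m : ℕ, eVariationOn (mPowerExt ν m) (Icc (0 : EReal) ⊤)).toReal)
      (fun m => (continuous_mPower m).continuousOn)
      (fun m t _ => abs_mPower_le_one hη.re_nonneg m t) ENNReal.toReal_nonneg
      (fun m => by
        rw [ENNReal.ofReal_toReal hvar.ne]
        exact (eVariationOn_mPower_le m).trans
          (le_iSup (fun m => eVariationOn (mPowerExt ν m) (Icc (0 : EReal) ⊤)) m))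
      (fun t _ => tendsto_mPower hη.im_eq_zero hη.re_nonneg t)
      (fun a b ha hb => intervalIntegrable_inversionKernel ξ ha hb)
      (tendsto_integral_inversionKernel ξ)
      (fun m => tendsto_integral_mPower_mul μX με μη hη.im_eq_zero hξ m) hJ'
    have hD : Tendsto (fun m => deconvFun μX με μη ξ m) atTop
        (𝓝 (cdfMid μX ξ + ∑ k ∈ Finset.Icc 1 K, v k)) := by
      simpa using hmain.const_add (cdfMid μX ξ)
    rw [Finset.sum_congr rfl hv, ← Complex.ofReal_sum, ← Complex.ofReal_add]
    exact (Complex.continuous_ofReal.tendsto _).comp hD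
  · refine Finset.sum_eq_zero fun k hk => fourierPsi_eq_zero_of_null (hpos k hk) (hle k hk) ξ ?_
    exact measure_mono_null (fun t ht => hτ.Icc_subset hk ht) h0
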